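/- A \emph{pseudo-finite group} is an infinite group which satisfies every first-order sentence in the pure language of groups that is true of all finite groups. \emph{Definable} means definable by a first-order formula in the pure language of groups, with parameters from the group. Let $G$ be a pseudo-finite group and let $i \in G$ be an involution (an element of order $2$) whose centralizer $C_G(i)$ is finite. Then $G$ has a definable normal subgroup $H$ of finite index whose derived subgroup $H'$ is contained in $C_G(i)$. In particular, $G$ is finite-by-abelian-by-finite: it has a normal subgroup $K$ of finite index which in turn has a finite normal subgroup $N$ such that $K/N$ is abelian. -/

import Mathlib

namespace PseudoFinite

open FirstOrder FirstOrder.Language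

/-- The function symbols of the pure language of groups `(·, ⁻¹, 1)`. -/
inductive GroupFunc : ℕ → Type
  | mul : GroupFunc 2
  | inv : GroupFunc 1
  | one : GroupFunc 0

/-- The pure (first-order) language of groups: it has no relation symbols besides equality. -/
def groupLanguage : FirstOrder.Language.{0, 0} where
  Functions := GroupFunc
  Relations := fun _ => Empty

/-- Every group is a structure for the language of groups, with the symbols interpreted by
its own operations. -/
instance groupStructure (G : Type*) [Group G] : groupLanguage.Structure G where
  funMap := fun {_} f =>
    match f with
    | GroupFunc.mul => fun x => x 0 * x 1
    | GroupFunc.inv => fun x => (x 0)⁻¹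
    | GroupFunc.one => fun _ => 1
  RelMap := fun {_} r => Empty.elim r

/-- A pseudo-finite group: an infinite group which satisfies every first-order sentence in the
pure language of groups that is true of all finite groups. (Every finite group is isomorphic to one
whose carrier lies in `Type`, so it does not matter in which universe the finite groups live.) -/
def IsPseudoFiniteGroup (G : Type*) [Group G] : Prop :=
  Infinite G ∧ ∀ φ : groupLanguage.Sentence,
    (∀ (F : Type) [Group F] [Finite F], F ⊨ φ) → G ⊨ φ

/-- A subgroup is definable if its underlying set is defined by a first-order formula in the pure
language of groups, with parameters from the group. -/
def IsDefinableSubgroup {G : Type*} [Group G] (H : Subgroup G) : Prop :=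
  (Set.univ : Set G).Definable₁ groupLanguage (H : Set G)

/-- A group is finite-by-abelian if it has a finite normal subgroup with abelian quotient. -/
def IsFiniteByAbelian (G : Type*) [Group G] : Prop :=
  ∃ (N : Subgroup G) (_ : N.Normal), Finite N ∧ ∀ a b : G ⧸ N, a * b = b * a

/-- A group is finite-by-abelian-by-finite if it has a finite-by-abelian normal subgroup of
finite index. -/
def IsFiniteByAbelianByFinite (G : Type*) [Group G] : Prop :=
  ∃ H : Subgroup G, H.Normal ∧ H.FiniteIndex ∧ IsFiniteByAbelian H

end PseudoFinite

/-! The proof bounds conjugacy classes in finite groups, transfers the bound to `G`, and then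
exploits the action of `i`.

Let `F` be finite of order `m`, with `i * i = 1` and at most `n` elements commuting with `i`. At
least `m / n` conjugates of `i` exist, and a product `g` of two of them is inverted by both, so `g`
arises from at most `|C(g)|` pairs. Averaging shows that a fixed proportion of elements have
centralizers of bounded index, and Ruzsa covering turns this into boundedly many translates
(`exists_translates_cover`). For fixed `n` this is first-order.

In `G` it follows that the FC-center `K` has finite index and bounded classes (`fcCenter_bounded`),
so `K'` is finite by Neumann's theorem. Take the `x` in `C_K(K')` that `i` inverts modulo `K'`: they
form a subgroup of finite index because `C(i)` is finite, and `i` fixes their commutators. Its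
normal core is `H`. -/

namespace PseudoFinite

open FirstOrder FirstOrder.Language

universe u v

/-! ### First-order formulas for centralizer indices -/

section Formulas

variable {α : Type v}

/-- The product of two terms of the language of groups. -/
def mulTerm (s t : groupLanguage.Term α) : groupLanguage.Term α :=
  Functions.apply₂ (GroupFunc.mul : groupLanguage.Functions 2) s t

/-- The inverse of a term of the language of groups. -/
def invTerm (t : groupLanguage.Term α) : groupLanguage.Term α :=
  Functions.apply₁ (GroupFunc.inv : groupLanguage.Functions 1) t

/-- The term for the neutral element. -/
def oneTerm : groupLanguage.Term α :=
  Constants.term (GroupFunc.one : groupLanguage.Functions 0)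

variable {G : Type u} [Group G] {w : α → G}

@[simp]
theorem realize_mulTerm {s t : groupLanguage.Term α} :
    (mulTerm s t).realize w = s.realize w * t.realize w :=
  Term.realize_functions_apply₂.trans rfl

@[simp]
theorem realize_invTerm {t : groupLanguage.Term α} :
    (invTerm t).realize w = (t.realize w)⁻¹ :=
  Term.realize_functions_apply₁.trans rfl

@[simp]
theorem realize_oneTerm : (oneTerm : groupLanguage.Term α).realize w = 1 :=
  Term.realize_constants.trans rfl

/-- The formula saying that two terms commute. -/
def commuteFormula (s t : groupLanguage.Term α) : groupLanguage.Formula α :=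
  (mulTerm s t).equal (mulTerm t s)

@[simp]
theorem realize_commuteFormula {s t : groupLanguage.Term α} :
    (commuteFormula s t).Realize w ↔ Commute (s.realize w) (t.realize w) := by
  simp [commuteFormula, Formula.realize_equal, commute_iff_eq]

/-- The formula saying that the centralizer of `t` is covered by `N` left cosets. -/
noncomputable def centralizerIndexFormula (N : ℕ) (t : groupLanguage.Term α) :
    groupLanguage.Formula α :=
  Formula.iExs (Fin N) <| Formula.iAlls Unit <| Formula.iSup fun k : Fin N =>
    commuteFormula
      (mulTerm (invTerm (Term.var (Sum.inl (Sum.inr k)))) (Term.var (Sum.inr ())))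
      (t.relabel (Sum.inl ∘ Sum.inl))

/-- The group is covered by `N` left cosets of the centralizer of `x`. -/
def CentralizerCovers (N : ℕ) (x : G) : Prop :=
  ∃ s : Fin N → G, ∀ h, ∃ k, Commute ((s k)⁻¹ * h) x

@[simp]
theorem realize_centralizerIndexFormula {N : ℕ} {t : groupLanguage.Term α} :
    (centralizerIndexFormula N t).Realize w ↔ CentralizerCovers N (t.realize w) := by
  simp only [centralizerIndexFormula, Formula.realize_iExs, Formula.realize_iAlls,
    Formula.realize_iSup, realize_commuteFormula, realize_mulTerm, realize_invTerm,
    Term.realize_var, Term.realize_relabel, CentralizerCovers, Sum.elim_inl, Sum.elim_inr]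
  refine exists_congr fun s => ⟨fun h g => h fun _ => g, fun h g => h (g ())⟩

/-- In a group with an involution (or the identity) `i` whose centralizer has at most `n` elements,
`M` left translates of the set of elements with centralizer of index at most `N` cover. -/
noncomputable def smallCentralizerSentence (n M N : ℕ) : groupLanguage.Sentence :=
  Formula.iAlls Unit <|
    ((mulTerm (Term.var (Sum.inr ())) (Term.var (Sum.inr ()))).equal oneTerm ⊓
      (Formula.iExs (Fin n) <| Formula.iAlls Unit <|
        (commuteFormula (Term.var (Sum.inr ())) (Term.var (Sum.inl (Sum.inl (Sum.inr ()))))).imp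
        (Formula.iSup fun k : Fin n =>
          (Term.var (Sum.inr ())).equal (Term.var (Sum.inl (Sum.inr k)))))).imp
    (Formula.iExs (Fin M) <| Formula.iAlls Unit <| Formula.iSup fun k : Fin M =>
      centralizerIndexFormula N
        (mulTerm (invTerm (Term.var (Sum.inl (Sum.inr k)))) (Term.var (Sum.inr ()))))

theorem realize_smallCentralizerSentence {n M N : ℕ} :
    G ⊨ smallCentralizerSentence n M N ↔
      ∀ i : G, i * i = 1 → (∃ c : Fin n → G, ∀ x, Commute x i → ∃ k, x = c k) →
        ∃ t : Fin M → G, ∀ g, ∃ k, CentralizerCovers N ((t k)⁻¹ * g) := by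
  simp only [smallCentralizerSentence, Sentence.Realize, Formula.realize_iExs,
    Formula.realize_iAlls,
    Formula.realize_iSup, realize_commuteFormula, realize_mulTerm, realize_invTerm,
    Term.realize_var, Sum.elim_inl, Sum.elim_inr, Formula.realize_imp, Formula.realize_inf,
    Formula.realize_equal, realize_oneTerm, realize_centralizerIndexFormula]
  constructor
  · rintro h i hi ⟨c, hc⟩
    obtain ⟨t, ht⟩ := h (fun _ => i) ⟨hi, c, fun x => hc (x ())⟩
    exact ⟨t, fun g => ht fun _ => g⟩
  · rintro h i ⟨hi, c, hc⟩
    obtain ⟨t, ht⟩ := h (i ()) hi ⟨c, fun x => hc fun _ => x⟩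
    exact ⟨t, fun g => ht (g ())⟩

end Formulas

/-- A set defined by a formula whose parameters are given as variables indexed by the group is
definable. -/
theorem definable₁_of_formula {G : Type u} [Group G] (S : Set G)
    (φ : groupLanguage.Formula (G ⊕ Unit))
    (hφ : ∀ x, φ.Realize (Sum.elim id fun _ => x) ↔ x ∈ S) :
    (Set.univ : Set G).Definable₁ groupLanguage S := by
  rw [Set.Definable₁, Set.definable_iff_exists_formula_sum]
  refine ⟨φ.relabel (Sum.map (fun g => ⟨g, trivial⟩) fun _ => 0), ?_⟩
  ext w
  simp only [Set.mem_ofPred_eq, Formula.realize_relabel, ← hφ]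
  refine iff_of_eq (congrArg _ ?_)
  ext (g | _) <;> rfl

end PseudoFinite

namespace PseudoFinite

universe u

open Subgroup
open scoped Pointwise commutatorElement

/-! ### Indices of element centralizers -/

section Index

variable {G : Type u} [Group G]

/-- The centralizer of an element. -/
abbrev cent (x : G) : Subgroup G := centralizer ({x} : Set G)

theorem mem_cent {x g : G} : g ∈ cent x ↔ Commute g x := by
  rw [mem_centralizer_singleton_iff]; exact Iff.rfl

theorem centralizerCovers_iff {N : ℕ} {x : G} :
    CentralizerCovers N x ↔ (cent x).index ≠ 0 ∧ (cent x).index ≤ N := by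
  constructor
  · rintro ⟨s, hs⟩
    have hsurj : Function.Surjective fun k => (s k : G ⧸ cent x) := by
      intro q
      induction q using QuotientGroup.induction_on with
      | H h =>
        obtain ⟨k, hk⟩ := hs h
        exact ⟨k, QuotientGroup.eq.2 (mem_cent.2 hk)⟩
    have := Finite.of_surjective _ hsurj
    refine ⟨Nat.card_pos.ne', ?_⟩
    simpa [index] using Nat.card_le_card_of_surjective _ hsurj
  · rintro ⟨h0, hN⟩
    have : Finite (G ⧸ cent x) := Nat.finite_of_card_ne_zero h0
    let e := (Finite.equivFin (G ⧸ cent x)).toEmbedding.trans (Fin.castLEEmb hN)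
    refine ⟨fun k => (Function.invFun e k).out, fun h => ⟨e h, ?_⟩⟩
    rw [← mem_cent, ← QuotientGroup.eq]
    dsimp only
    rw [Function.leftInverse_invFun e.injective]
    exact QuotientGroup.out_eq' _

theorem cent_inf_le_cent_mul (x y : G) : cent x ⊓ cent y ≤ cent (x * y) := fun _ hg =>
  mem_cent.2 ((mem_cent.1 hg.1).mul_right (mem_cent.1 hg.2))

theorem cent_inv (x : G) : cent x⁻¹ = cent x := by
  ext g; rw [mem_cent, mem_cent, Commute.inv_right_iff]

theorem index_cent_mul_ne_zero {x y : G} (hx : (cent x).index ≠ 0) (hy : (cent y).index ≠ 0) :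
    (cent (x * y)).index ≠ 0 :=
  ne_zero_of_dvd_ne_zero (index_inf_ne_zero hx hy) (index_dvd_of_le (cent_inf_le_cent_mul x y))

theorem index_cent_mul_le {x y : G} (hx : (cent x).index ≠ 0) (hy : (cent y).index ≠ 0) :
    (cent (x * y)).index ≤ (cent x).index * (cent y).index :=
  (Nat.le_of_dvd (Nat.pos_of_ne_zero (index_inf_ne_zero hx hy))
    (index_dvd_of_le (cent_inf_le_cent_mul x y))).trans index_inf_le

end Index

/-! ### Counting in finite groups -/

section FiniteGroup

variable {F : Type u} [Group F] [Finite F]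

/-- The pairs of conjugates of `i` with product `g` are at most as many as the elements
commuting with `g`. -/
theorem card_conjugate_pairs_le [DecidableEq F] {i : F} (hi : i * i = 1) (g : F)
    (I : Finset F) (hI : ∀ j ∈ I, ∃ a, j = a * i * a⁻¹) :
    ((I ×ˢ I).filter fun p => p.1 * p.2 = g).card ≤ Nat.card (cent g) := by
  have hsq : ∀ j ∈ I, j * j = 1 := by
    intro j hj
    obtain ⟨a, rfl⟩ := hI j hj
    calc a * i * a⁻¹ * (a * i * a⁻¹) = a * (i * i) * a⁻¹ := by group
      _ = 1 := by rw [hi]; group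
  have hconj : ∀ p ∈ (I ×ˢ I).filter fun p => p.1 * p.2 = g, p.1 * g * p.1⁻¹ = g⁻¹ := by
    intro p hp
    obtain ⟨hp', rfl⟩ := Finset.mem_filter.1 hp
    obtain ⟨h1, h2⟩ := Finset.mem_product.1 hp'
    rw [mul_inv_rev, ← mul_assoc, hsq _ h1, one_mul, inv_eq_of_mul_eq_one_left (hsq _ h2)]
  rcases Finset.eq_empty_or_nonempty ((I ×ˢ I).filter fun p => p.1 * p.2 = g) with h | ⟨p₀, hp₀⟩
  · simp [h]
  · classical
    have := Fintype.ofFinite (cent g)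
    rw [Nat.card_eq_fintype_card, ← Finset.card_univ]
    -- Elements conjugating `g` to `g⁻¹` form one coset of `cent g`; the second coordinate is
    -- determined by the first.
    have key : ∀ p ∈ (I ×ˢ I).filter fun p => p.1 * p.2 = g, Commute (p₀.1⁻¹ * p.1) g := by
      intro p hp
      have h1 := hconj p hp
      rw [← hconj p₀ hp₀, mul_inv_eq_iff_eq_mul] at h1
      rw [commute_iff_eq, mul_assoc, h1]; group
    refine Finset.card_le_card_of_injOn
      (fun p => if h : Commute (p₀.1⁻¹ * p.1) g then ⟨p₀.1⁻¹ * p.1, mem_cent.2 h⟩ else 1)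
      (fun _ _ => Finset.mem_coe.2 (Finset.mem_univ _)) ?_
    intro p hp q hq hpq
    have hp1 := key p hp
    have hq1 := key q hq
    have h1 : p.1 = q.1 := by simpa [hp1, hq1] using hpq
    have h2 : p.1 * p.2 = q.1 * q.2 :=
      (Finset.mem_filter.1 hp).2.trans (Finset.mem_filter.1 hq).2.symm
    rw [h1] at h2
    exact Prod.ext h1 (mul_left_cancel h2)

/-- With `r = 2 * n ^ 2`, elements of centralizer index above `r` account for at most half of the
conjugate pairs, so the set `T` of the others has at least `m / r` elements. -/
theorem exists_translates_cover {i : F} (hi : i * i = 1) {n : ℕ}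
    (hn : Nat.card (cent i) ≤ n) :
    ∃ t : Fin (2 * n ^ 2) → F, ∀ g, ∃ k,
      CentralizerCovers ((2 * n ^ 2) * (2 * n ^ 2)) ((t k)⁻¹ * g) := by
  classical
  have := Fintype.ofFinite F
  set r := 2 * n ^ 2 with hr
  set m := Fintype.card F with hm
  have hm0 : 0 < m := Fintype.card_pos
  set I : Finset F := Finset.univ.image fun a => a * i * a⁻¹ with hI
  have hmI : m ≤ n * I.card := by
    refine Finset.card_le_mul_card_image _ _ fun b hb => le_trans ?_ hn
    obtain ⟨a, -, rfl⟩ := Finset.mem_image.1 hb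
    rw [Nat.card_eq_fintype_card, ← Finset.card_univ]
    refine Finset.card_le_card_of_injOn
      (fun x => if h : Commute (a⁻¹ * x) i then ⟨a⁻¹ * x, mem_cent.2 h⟩ else 1)
      (fun _ _ => Finset.mem_coe.2 (Finset.mem_univ _)) ?_
    have key : ∀ x, x * i * x⁻¹ = a * i * a⁻¹ → Commute (a⁻¹ * x) i := by
      intro x hx
      rw [mul_inv_eq_iff_eq_mul] at hx
      rw [commute_iff_eq, mul_assoc, hx]; group
    intro x hx y hy hxy
    have hx := key x (by simpa using hx)
    have hy := key y (by simpa using hy)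
    simpa [hx, hy] using hxy
  set T : Finset F := Finset.univ.filter fun g => (cent g).index ≤ r with hT
  have hcount : r * I.card ^ 2 ≤ m * m + r * m * T.card := by
    have h1 : I.card ^ 2 ≤ ∑ g : F, Nat.card (cent g) := by
      rw [sq, ← Finset.card_product, Finset.card_eq_sum_card_fiberwise
        (f := fun p => p.1 * p.2) (t := Finset.univ)
        (fun _ _ => Finset.mem_coe.2 (Finset.mem_univ _))]
      exact Finset.sum_le_sum fun g _ => card_conjugate_pairs_le hi g I
        fun j hj => by simpa [hI, eq_comm] using hj
    calc r * I.card ^ 2 ≤ ∑ g : F, r * Nat.card (cent g) := by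
          rw [← Finset.mul_sum]; exact Nat.mul_le_mul_left _ h1
      _ ≤ ∑ g : F, (m + if g ∈ T then r * m else 0) := by
          refine Finset.sum_le_sum fun g _ => ?_
          have hmul : Nat.card (cent g) * (cent g).index = m := by
            rw [card_mul_index, Nat.card_eq_fintype_card]
          split_ifs with hg
          · have : Nat.card (cent g) ≤ m :=
              Nat.le_of_dvd hm0 ⟨_, hmul.symm⟩
            nlinarith
          · have hlt : r < (cent g).index := by simpa [hT] using hg
            nlinarith
      _ = m * m + r * m * T.card := by
          rw [Finset.sum_add_distrib, Finset.sum_ite_mem]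
          simp [hm, mul_comm]
  have hTm : m ≤ r * T.card := by
    have h2 : m * m ≤ n ^ 2 * I.card ^ 2 := by
      rw [← mul_pow, sq]; exact Nat.mul_le_mul hmI hmI
    have h3 : m * m ≤ m * (r * T.card) := by nlinarith
    exact Nat.le_of_mul_le_mul_left h3 hm0
  have hTne : T.Nonempty := by
    rw [Finset.nonempty_iff_ne_empty]
    rintro h
    rw [h, Finset.card_empty] at hTm
    omega
  -- Ruzsa: at most `r` translates of `T / T` cover, and indices on `T / T` are at most `r * r`.
  obtain ⟨S, -, hS, hcov⟩ := Finset.ruzsa_covering_mul (A := Finset.univ) (K := (r : ℝ)) hTne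
    (by exact_mod_cast (Finset.card_le_univ _).trans hTm)
  replace hS : S.card ≤ r := by exact_mod_cast hS
  have hSne : S.Nonempty := by
    rw [Finset.nonempty_iff_ne_empty]
    rintro rfl
    simpa using hcov (Finset.mem_univ (1 : F))
  have : Nonempty S := hSne.to_subtype
  let e : S ↪ Fin r := S.equivFin.toEmbedding.trans (Fin.castLEEmb hS)
  refine ⟨fun k => (Function.invFun e k : S), fun g => ?_⟩
  obtain ⟨s, hs, q, hq, rfl⟩ := Finset.mem_mul.1 (hcov (Finset.mem_univ g))
  obtain ⟨a, ha, b, hb, rfl⟩ := Finset.mem_div.1 hq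
  refine ⟨e ⟨s, hs⟩, ?_⟩
  dsimp only
  rw [Function.leftInverse_invFun e.injective, centralizerCovers_iff]
  have h0 : ∀ x : F, (cent x).index ≠ 0 := fun x => index_ne_zero_of_finite
  refine ⟨h0 _, ?_⟩
  rw [inv_mul_cancel_left, div_eq_mul_inv]
  refine (index_cent_mul_le (h0 _) (h0 _)).trans (Nat.mul_le_mul ?_ ?_)
  · simpa [hT] using ha
  · rw [cent_inv]; simpa [hT] using hb

end FiniteGroup

/-! ### Neumann's theorem on bounded conjugacy classes -/

section BoundedClasses

variable {A : Type u} [Group A]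

theorem finite_conjugates {x : A} (hx : (cent x).index ≠ 0) :
    (Set.range fun g => g * x * g⁻¹).Finite := by
  have : Finite (A ⧸ cent x) := Nat.finite_of_card_ne_zero hx
  refine (Set.finite_range fun q : A ⧸ cent x => q.out * x * q.out⁻¹).subset ?_
  rintro _ ⟨g, rfl⟩
  refine ⟨(g : A ⧸ cent x), ?_⟩
  have h : Commute ((g : A ⧸ cent x).out⁻¹ * g) x :=
    mem_cent.1 (QuotientGroup.eq.1 (QuotientGroup.out_eq' _))
  set b := (g : A ⧸ cent x).out
  change b * x * b⁻¹ = g * x * g⁻¹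
  rw [mul_inv_eq_iff_eq_mul]
  calc b * x = b * (x * (b⁻¹ * g)) * g⁻¹ * b := by group
    _ = g * x * g⁻¹ * b := by rw [← h.eq]; group

/-- B. H. Neumann: a group with conjugacy classes of bounded size has finite derived subgroup. -/
theorem finite_commutatorSet_of_bounded {N : ℕ}
    (h : ∀ x : A, (cent x).index ≠ 0 ∧ (cent x).index ≤ N) : Finite (commutatorSet A) := by
  obtain ⟨a, ha⟩ : ∃ a : A, ∀ x : A, (cent x).index ≤ (cent a).index := by
    have hb : BddAbove (Set.range fun x : A => (cent x).index) :=
      ⟨N, by rintro _ ⟨x, rfl⟩; exact (h x).2⟩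
    obtain ⟨a, ha⟩ := Nat.sSup_mem (Set.range_nonempty fun x : A => (cent x).index) hb
    exact ⟨a, fun x => (le_csSup hb ⟨x, rfl⟩).trans ha.ge⟩
  have hfin : ∀ x : A, Finite (A ⧸ cent x) := fun x => Nat.finite_of_card_ne_zero (h x).1
  have := hfin a
  let C : Subgroup A := ⨅ q : A ⧸ cent a, cent q.out
  have hC : C.index ≠ 0 := index_iInf_ne_zero fun q => (h _).1
  have : Finite (A ⧸ C) := Nat.finite_of_card_ne_zero hC
  let D : Set A := Set.image2 (fun u v => u⁻¹ * v) (Set.range fun g => g * a * g⁻¹)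
    (Set.range fun g => g * a * g⁻¹)
  have hD : D.Finite := (finite_conjugates (h a).1).image2 _ (finite_conjugates (h a).1)
  have hcomm : ∀ c ∈ C, ∀ x : A, ⁅x, c⁆ ∈ D := by
    intro c hc x
    have hcb : ∀ q : A ⧸ cent a, Commute q.out c := fun q =>
      (mem_cent.1 ((mem_iInf.1 hc) q)).symm
    have := hfin (a * c)
    let f : A ⧸ cent a → A ⧸ cent (a * c) := fun q => q.out
    have hf : Function.Injective f := by
      intro q q' hqq
      have h1 : Commute (q.out⁻¹ * q'.out) (a * c) := mem_cent.1 (QuotientGroup.eq.1 hqq)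
      have h2 : Commute (q.out⁻¹ * q'.out) c := (hcb q).inv_left.mul_left (hcb q')
      have h3 : Commute (q.out⁻¹ * q'.out) a := by
        simpa using h1.mul_right h2.inv_right
      rw [← QuotientGroup.out_eq' q, ← QuotientGroup.out_eq' q']
      exact QuotientGroup.eq.2 (mem_cent.2 h3)
    -- By maximality of the class of `a`, the representatives of `A ⧸ cent a` already yield every
    -- conjugate of `a * c`.
    obtain ⟨q, hq⟩ := (hf.bijective_of_nat_card_le (ha (a * c))).2 x
    have hz : Commute (q.out⁻¹ * x) (a * c) := mem_cent.1 (QuotientGroup.eq.1 hq)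
    have hqc := hcb q
    set b := q.out
    refine ⟨x * a * x⁻¹, ⟨x, rfl⟩, b * a * b⁻¹, ⟨b, rfl⟩, ?_⟩
    have h1 : x * (a * c) * x⁻¹ = b * a * b⁻¹ * c := by
      calc x * (a * c) * x⁻¹ = b * (b⁻¹ * x * (a * c)) * x⁻¹ := by group
        _ = b * a * (c * b⁻¹) := by rw [hz.eq]; group
        _ = b * a * b⁻¹ * c := by rw [← hqc.inv_left.eq]; group
    calc (x * a * x⁻¹)⁻¹ * (b * a * b⁻¹)
        = (x * a * x⁻¹)⁻¹ * (b * a * b⁻¹ * c) * c⁻¹ := by group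
      _ = ⁅x, c⁆ := by rw [← h1, commutatorElement_def]; group
  -- Write `y = t * c` with `t` a representative and `c ∈ C`; then `⁅x, y⁆ = ⁅x, t⁆ * (t * ⁅x, c⁆ *
  -- t⁻¹)`.
  refine Set.Finite.subset (s := ⋃ q : A ⧸ C, Set.image2 (fun u v => u * q.out⁻¹ *
    (q.out * v * q.out⁻¹)) (Set.range fun g => g * q.out * g⁻¹) D)
    (Set.finite_iUnion fun q => (finite_conjugates (h _).1).image2 _ hD) ?_
  rintro _ ⟨x, y, rfl⟩
  refine Set.mem_iUnion.2 ⟨(y : A ⧸ C), ?_⟩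
  have hc : (y : A ⧸ C).out⁻¹ * y ∈ C := QuotientGroup.eq.1 (QuotientGroup.out_eq' _)
  set t := (y : A ⧸ C).out
  refine ⟨_, ⟨x, rfl⟩, _, hcomm _ hc x, ?_⟩
  simp only [commutatorElement_def]
  group

end BoundedClasses

end PseudoFinite

namespace PseudoFinite

universe u

open FirstOrder FirstOrder.Language Subgroup
open scoped commutatorElement

/-! ### Transfer to `G` and its FC-center -/

section

variable {G : Type u} [Group G]

theorem IsPseudoFiniteGroup.exists_translates_cover (hG : IsPseudoFiniteGroup G) {i : G}
    (hi : i * i = 1) (hfin : Finite (cent i)) :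
    ∃ (r N : ℕ) (t : Fin r → G), ∀ g, ∃ k, CentralizerCovers N ((t k)⁻¹ * g) := by
  let n := Nat.card (cent i)
  have hφ := hG.2 (smallCentralizerSentence n (2 * n ^ 2) ((2 * n ^ 2) * (2 * n ^ 2))) <| by
    intro F _ _
    rw [realize_smallCentralizerSentence]
    rintro i hi ⟨c, hc⟩
    refine PseudoFinite.exists_translates_cover hi ?_
    have hex : ∀ x : cent i, ∃ k, (x : F) = c k := fun x => hc x (mem_cent.1 x.2)
    choose f hf using hex
    have hinj : Function.Injective f := fun x y hxy => Subtype.ext (by rw [hf, hf, hxy])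
    simpa using Nat.card_le_card_of_injective f hinj
  rw [realize_smallCentralizerSentence] at hφ
  refine ⟨_, _, hφ i hi ⟨fun k => ((Finite.equivFin (cent i)).symm k : G), fun x hx => ?_⟩⟩
  exact ⟨Finite.equivFin (cent i) ⟨x, mem_cent.2 hx⟩, by simp⟩

theorem index_cent_conj_ne_zero {x : G} (hx : (cent x).index ≠ 0) (g : G) :
    (cent (g * x * g⁻¹)).index ≠ 0 := by
  have h : (cent x).comap (MulAut.conj g⁻¹).toMonoidHom ≤ cent (g * x * g⁻¹) := by
    intro y hy
    have hy : Commute (g⁻¹ * y * g) x := by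
      simpa [mem_cent] using hy
    rw [mem_cent, commute_iff_eq]
    calc y * (g * x * g⁻¹) = g * (g⁻¹ * y * g * x) * g⁻¹ := by group
      _ = g * x * g⁻¹ * y := by rw [hy.eq]; group
  refine ne_zero_of_dvd_ne_zero ?_ (index_dvd_of_le h)
  rwa [index_comap_of_surjective _ (MulAut.conj g⁻¹).surjective]

variable (G) in
/-- The subgroup of elements with finitely many conjugates. -/
def fcCenter : Subgroup G where
  carrier := {x | (cent x).index ≠ 0}
  mul_mem' := index_cent_mul_ne_zero
  one_mem' := by
    have h : cent (1 : G) = ⊤ := eq_top_iff.2 fun g _ => mem_cent.2 (Commute.one_right g)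
    simp [h]
  inv_mem' {x} hx := by simpa only [Set.mem_ofPred_eq, cent_inv] using hx

instance : (fcCenter G).Normal := ⟨fun _ hx g => index_cent_conj_ne_zero hx g⟩

theorem fcCenter_bounded {r N : ℕ} {t : Fin r → G}
    (ht : ∀ g, ∃ k, CentralizerCovers N ((t k)⁻¹ * g)) :
    (fcCenter G).FiniteIndex ∧ ∃ B, ∀ x, x ∈ fcCenter G ↔ CentralizerCovers B x := by
  simp only [centralizerCovers_iff] at ht ⊢
  constructor
  · have hsurj : Function.Surjective fun k => (t k : G ⧸ fcCenter G) := by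
      intro q
      induction q using QuotientGroup.induction_on with
      | H g =>
        obtain ⟨k, hk⟩ := ht g
        exact ⟨k, QuotientGroup.eq.2 hk.1⟩
    have := Finite.of_surjective _ hsurj
    exact finiteIndex_of_finite_quotient
  -- For `x` in the FC-center, its translate `t k` lies there too; the remaining `t k` have index 0
  -- and add nothing to the sum.
  · refine ⟨(∑ k, (cent (t k)).index) * N, fun x => ⟨fun hx => ⟨hx, ?_⟩, fun hx => hx.1⟩⟩
    obtain ⟨k, hk⟩ := ht x
    have htk : t k ∈ fcCenter G := by
      have := (fcCenter G).mul_mem hx ((fcCenter G).inv_mem hk.1)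
      simpa using this
    have := index_cent_mul_le htk hk.1
    rw [mul_inv_cancel_left] at this
    exact this.trans (Nat.mul_le_mul
      (Finset.single_le_sum (f := fun k => (cent (t k)).index) (fun _ _ => Nat.zero_le _)
        (Finset.mem_univ k)) hk.2)

theorem finite_commutator_of_bounded {K : Subgroup G} {B : ℕ}
    (hB : ∀ x ∈ K, CentralizerCovers B x) : Finite ↥⁅K, K⁆ := by
  have hK : ∀ x : K, (cent x).index ≠ 0 ∧ (cent x).index ≤ B := by
    intro x
    obtain ⟨h0, hle⟩ := centralizerCovers_iff.1 (hB x x.2)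
    have heq : cent x = (cent (x : G)).subgroupOf K := by
      ext y
      rw [mem_subgroupOf, mem_cent, mem_cent, commute_iff_eq, commute_iff_eq, Subtype.ext_iff]
      rfl
    have hle' : (cent (x : G)).relIndex K ≤ (cent (x : G)).relIndex ⊤ :=
      relIndex_le_of_le_right le_top (by rwa [relIndex_top_right])
    rw [relIndex_top_right] at hle'
    rw [heq]
    exact ⟨fun h => h0 (index_eq_zero_of_relIndex_eq_zero h), hle'.trans hle⟩
  have := finite_commutatorSet_of_bounded hK
  have hfin : Finite (_root_.commutator K) := inferInstance
  rw [← map_subtype_commutator]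
  exact Finite.of_equiv _ ((_root_.commutator K).equivMapOfInjective _ K.subtype_injective).toEquiv

end

/-! ### Elements inverted by the involution -/

section Involution

variable {G : Type u} [Group G] (i : G) (K : Subgroup G) [K.Normal]

/-- The homomorphism from the centralizer in `K` of `⁅K, K⁆` to `G ⧸ ⁅K, K⁆` which sends `x` to
the class of `x * (i * x * i⁻¹)`. -/
def twistHom : (K ⊓ centralizer ((⁅K, K⁆ : Subgroup G) : Set G) : Subgroup G) →* G ⧸ ⁅K, K⁆ where
  toFun x := ((x * (i * x * i⁻¹) : G) : G ⧸ ⁅K, K⁆)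
  map_one' := by simp
  map_mul' x y := by
    have h : ((i * x * i⁻¹ : G) : G ⧸ ⁅K, K⁆) * (y : G) =
        (y : G) * ((i * x * i⁻¹ : G) : G ⧸ ⁅K, K⁆) := by
      rw [← QuotientGroup.mk_mul, ← QuotientGroup.mk_mul, QuotientGroup.eq]
      have h1 := commutator_mem_commutator (K.inv_mem y.2.1)
        (K.inv_mem ((inferInstance : K.Normal).conj_mem _ x.2.1 i))
      convert h1 using 1
      rw [commutatorElement_def]
      group
    have h2 : ((x * y : G) * (i * (x * y : G) * i⁻¹)) =
        x * ((y : G) * (i * x * i⁻¹)) * (i * y * i⁻¹) := by group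
    have h3 : ((x * (i * x * i⁻¹)) * (y * (i * y * i⁻¹)) : G) =
        x * ((i * x * i⁻¹) * (y : G)) * (i * y * i⁻¹) := by group
    rw [← QuotientGroup.mk_mul, h3, coe_mul, h2]
    simp only [QuotientGroup.mk_mul] at h ⊢
    rw [h]

/-- The elements of `K` centralizing `⁅K, K⁆` which are inverted by `i` modulo `⁅K, K⁆`. -/
def invertedSubgroup : Subgroup G := (twistHom i K).ker.map (Subgroup.subtype _)

variable {i K}

theorem mem_invertedSubgroup {x : G} : x ∈ invertedSubgroup i K ↔
    x ∈ K ∧ (∀ d ∈ ⁅K, K⁆, Commute d x) ∧ x * (i * x * i⁻¹) ∈ ⁅K, K⁆ := by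
  constructor
  · rintro ⟨y, hy, rfl⟩
    exact ⟨y.2.1, fun d hd => mem_centralizer_iff.1 y.2.2 d hd, (QuotientGroup.eq_one_iff _).1 hy⟩
  · rintro ⟨h1, h2, h3⟩
    exact ⟨⟨x, h1, mem_centralizer_iff.2 h2⟩, (QuotientGroup.eq_one_iff _).2 h3, rfl⟩

theorem finiteIndex_invertedSubgroup [hK : K.FiniteIndex] (hi : i * i = 1) (hfin : Finite (cent i))
    (hfc : K ≤ fcCenter G) [Finite ↥⁅K, K⁆] : (invertedSubgroup i K).FiniteIndex := by
  have hinv : i⁻¹ = i := inv_eq_of_mul_eq_one_left hi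
  have hC : (centralizer ((⁅K, K⁆ : Subgroup G) : Set G)).FiniteIndex := by
    have hle : ⨅ d : ↥⁅K, K⁆, cent (d : G) ≤ centralizer ((⁅K, K⁆ : Subgroup G) : Set G) := by
      intro x hx
      rw [mem_centralizer_iff]
      intro d hd
      exact (mem_cent.1 (mem_iInf.1 hx ⟨d, hd⟩)).symm
    have : (⨅ d : ↥⁅K, K⁆, cent (d : G)).FiniteIndex :=
      finiteIndex_iInf fun d => ⟨hfc (commutator_le_left K K d.2)⟩
    exact finiteIndex_of_le hle
  -- Each fibre of `y ↦ y⁻¹ * (i * y * i⁻¹)` lies in a right coset of the finite group `cent i`.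
  -- This set contains representatives of the whole range of `twistHom`.
  have hY : {y : G | y⁻¹ * (i * y * i⁻¹) ∈ ⁅K, K⁆}.Finite := by
    refine Set.Finite.preimage' (f := fun y : G => y⁻¹ * (i * y * i⁻¹))
      (Set.toFinite ((⁅K, K⁆ : Subgroup G) : Set G)) fun b _ => ?_
    rcases Set.eq_empty_or_nonempty ((fun y : G => y⁻¹ * (i * y * i⁻¹)) ⁻¹' {b}) with h | ⟨y₀, h₀⟩
    · rw [h]; exact Set.finite_empty
    · refine ((Set.toFinite (cent i : Set G)).image fun z => z * y₀).subset ?_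
      intro y hy
      refine ⟨y * y₀⁻¹, mem_cent.2 ?_, by simp⟩
      have h : y⁻¹ * (i * y * i⁻¹) = y₀⁻¹ * (i * y₀ * i⁻¹) := hy.trans h₀.symm
      have h' : y⁻¹ * i * y = y₀⁻¹ * i * y₀ := by
        have := congrArg (· * i) h
        simpa [mul_assoc] using this
      rw [commute_iff_eq]
      calc y * y₀⁻¹ * i = y * (y₀⁻¹ * i * y₀) * y₀⁻¹ := by group
        _ = i * (y * y₀⁻¹) := by rw [← h']; group
  have hrange : Finite (twistHom i K).range := by
    refine (hY.image (QuotientGroup.mk : G → G ⧸ ⁅K, K⁆)).subset ?_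
    rintro _ ⟨x, rfl⟩
    refine ⟨x * (i * x * i⁻¹), ?_, rfl⟩
    have h1 := commutator_mem_commutator (K.inv_mem ((inferInstance : K.Normal).conj_mem _ x.2.1 i))
      (K.inv_mem x.2.1)
    change (x * (i * x * i⁻¹) : G)⁻¹ * (i * (x * (i * x * i⁻¹)) * i⁻¹) ∈ ⁅K, K⁆
    convert h1 using 1
    rw [commutatorElement_def, hinv]
    calc (x * (i * x * i) : G)⁻¹ * (i * (x * (i * x * i)) * i)
        = (i * x * i)⁻¹ * (x : G)⁻¹ * (i * x * i) * x * (i * i) := by group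
      _ = _ := by rw [hi]; group
  have := finiteIndex_ker (twistHom i K)
  refine ⟨?_⟩
  rw [invertedSubgroup, index_map_subtype]
  exact mul_ne_zero this.index_ne_zero (index_inf_ne_zero hK.index_ne_zero hC.index_ne_zero)

/-- Conjugation by `i` sends `x, y` to `x⁻¹ * d, y⁻¹ * e` with `d, e ∈ ⁅K, K⁆`. The factors `d, e`
cancel in the commutator, and `⁅x⁻¹, y⁻¹⁆ = ⁅x, y⁆` because `⁅x, y⁆` commutes with `x` and `y`. -/
theorem commutator_invertedSubgroup_le :
    ⁅invertedSubgroup i K, invertedSubgroup i K⁆ ≤ cent i := by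
  rw [commutator_le]
  intro x hx y hy
  obtain ⟨hxK, hxc, hxd⟩ := mem_invertedSubgroup.1 hx
  obtain ⟨hyK, hyc, hyd⟩ := mem_invertedSubgroup.1 hy
  have hconj : ∀ d ∈ ⁅K, K⁆, Commute d (i * x * i⁻¹) := fun d hd => by
    have := (hxc (i⁻¹ * d * i) (by
      simpa using (inferInstance : (⁅K, K⁆ : Subgroup G).Normal).conj_mem d hd i⁻¹))
    rw [commute_iff_eq]
    calc d * (i * x * i⁻¹) = i * (i⁻¹ * d * i * x) * i⁻¹ := by group
      _ = i * x * i⁻¹ * d := by rw [this.eq]; group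
  set d := x * (i * x * i⁻¹) with hd
  set e := y * (i * y * i⁻¹) with he
  have hx' : i * x * i⁻¹ = x⁻¹ * d := by rw [hd]; group
  have hy' : i * y * i⁻¹ = y⁻¹ * e := by rw [he]; group
  have hde : Commute e d := (hxc e hyd).mul_right (hconj e hyd)
  have hc : ⁅x, y⁆ ∈ ⁅K, K⁆ := commutator_mem_commutator hxK hyK
  have hcx := hxc _ hc
  have hcy := hyc _ hc
  rw [mem_cent]
  have h1 : i * ⁅x, y⁆ * i⁻¹ = ⁅i * x * i⁻¹, i * y * i⁻¹⁆ := by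
    simp only [commutatorElement_def]; group
  have h2 : ⁅x⁻¹ * d, y⁻¹ * e⁆ = ⁅x⁻¹, y⁻¹⁆ := by
    have hdy : Commute d y⁻¹ := (hyc d hxd).inv_right
    have hex : Commute e x⁻¹ := (hxc e hyd).inv_right
    simp only [commutatorElement_def]
    calc x⁻¹ * d * (y⁻¹ * e) * (x⁻¹ * d)⁻¹ * (y⁻¹ * e)⁻¹
        = x⁻¹ * (d * y⁻¹) * (e * d⁻¹) * x⁻¹⁻¹ * e⁻¹ * y⁻¹⁻¹ := by group
      _ = x⁻¹ * y⁻¹ * (d * d⁻¹) * (e * x⁻¹⁻¹) * e⁻¹ * y⁻¹⁻¹ := by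
          rw [hdy.eq, hde.inv_right.eq]; group
      _ = x⁻¹ * y⁻¹ * x⁻¹⁻¹ * y⁻¹⁻¹ := by rw [hex.inv_right.eq]; group
  have h3 : ⁅x⁻¹, y⁻¹⁆ = ⁅x, y⁆ := by
    have h4 : ⁅x⁻¹, y⁻¹⁆ = x⁻¹ * y⁻¹ * (⁅x, y⁆ * (y * x)) := by
      simp only [commutatorElement_def]; group
    rw [h4, (hcy.mul_right hcx).eq]; group
  rw [hx', hy', h2, h3, mul_inv_eq_iff_eq_mul] at h1
  exact h1.symm

/-- The bound `B` makes `K` definable, the finitely many elements of `⁅K, K⁆` serve as parameters,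
and the core is a quantifier over conjugates. -/
theorem isDefinableSubgroup_normalCore_invertedSubgroup {B : ℕ}
    (hB : ∀ x, x ∈ K ↔ CentralizerCovers B x) [Finite ↥⁅K, K⁆] :
    IsDefinableSubgroup (invertedSubgroup i K).normalCore := by
  let c (g : G) : groupLanguage.Term ((G ⊕ Unit) ⊕ Unit) := Term.var (Sum.inl (Sum.inl g))
  let x : groupLanguage.Term ((G ⊕ Unit) ⊕ Unit) := Term.var (Sum.inl (Sum.inr ()))
  let g : groupLanguage.Term ((G ⊕ Unit) ⊕ Unit) := Term.var (Sum.inr ())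
  let y := mulTerm (mulTerm g x) (invTerm g)
  refine definable₁_of_formula _ (Formula.iAlls Unit (centralizerIndexFormula B y ⊓
    ((Formula.iInf fun d : ↥⁅K, K⁆ => commuteFormula (c d) y) ⊓
      Formula.iSup fun d : ↥⁅K, K⁆ =>
        (mulTerm y (mulTerm (mulTerm (c i) y) (invTerm (c i)))).equal (c d)))) fun a => ?_
  simp only [Formula.realize_iAlls, Formula.realize_inf, Formula.realize_iInf,
    Formula.realize_iSup, realize_centralizerIndexFormula, realize_commuteFormula,
    Formula.realize_equal, realize_mulTerm, realize_invTerm, Term.realize_var, c, x, g, y,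
    Sum.elim_inl, Sum.elim_inr, id_eq]
  change _ ↔ ∀ b : G, b * a * b⁻¹ ∈ invertedSubgroup i K
  simp only [mem_invertedSubgroup, hB]
  refine ⟨fun h b => ?_, fun h b => ?_⟩
  · obtain ⟨h1, h2, d, h3⟩ := h fun _ => b
    exact ⟨h1, fun d hd => h2 ⟨d, hd⟩, h3 ▸ d.2⟩
  · obtain ⟨h1, h2, h3⟩ := h (b ())
    exact ⟨h1, fun d => h2 d d.2, ⟨_, h3⟩, rfl⟩

end Involution

theorem isFiniteByAbelian_of_finite_commutator {G : Type u} [Group G] (H : Subgroup G)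
    [Finite ↥⁅H, H⁆] : IsFiniteByAbelian H := by
  refine ⟨_root_.commutator H, inferInstance, ?_, ?_⟩
  · have h : Finite ((_root_.commutator H).map H.subtype) := by
      rwa [map_subtype_commutator]
    exact Finite.of_equiv _
      ((_root_.commutator H).equivMapOfInjective _ H.subtype_injective).symm.toEquiv
  · intro a b
    exact @mul_comm (Abelianization H) _ a b

end PseudoFinite

theorem mainTheorem1 {G : Type*} [Group G] (hG : PseudoFinite.IsPseudoFiniteGroup G)
    (i : G) (hi : orderOf i = 2) (hfin : Finite (Subgroup.centralizer ({i} : Set G))) :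
    (∃ H : Subgroup G, H.Normal ∧ H.FiniteIndex ∧ PseudoFinite.IsDefinableSubgroup H ∧
      ⁅H, H⁆ ≤ Subgroup.centralizer ({i} : Set G)) ∧
    PseudoFinite.IsFiniteByAbelianByFinite G := by
  have hi2 : i * i = 1 := by rw [← sq, ← hi, pow_orderOf_eq_one]
  obtain ⟨r, N, t, ht⟩ := hG.exists_translates_cover hi2 hfin
  obtain ⟨hK, B, hB⟩ := PseudoFinite.fcCenter_bounded ht
  have := PseudoFinite.finite_commutator_of_bounded fun x hx => (hB x).1 hx
  have hH := PseudoFinite.finiteIndex_invertedSubgroup (K := PseudoFinite.fcCenter G)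
    hi2 hfin le_rfl
  set H := (PseudoFinite.invertedSubgroup i (PseudoFinite.fcCenter G)).normalCore with hHdef
  have hcomm : ⁅H, H⁆ ≤ Subgroup.centralizer ({i} : Set G) :=
    (Subgroup.commutator_mono (Subgroup.normalCore_le _) (Subgroup.normalCore_le _)).trans
      PseudoFinite.commutator_invertedSubgroup_le
  have hHfin : H.FiniteIndex := Subgroup.finiteIndex_normalCore _
  have hHn : H.Normal := Subgroup.normalCore_normal _
  refine ⟨⟨H, hHn, hHfin,
    PseudoFinite.isDefinableSubgroup_normalCore_invertedSubgroup hB, hcomm⟩, H, hHn, hHfin, ?_⟩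
  have : Finite ↥⁅H, H⁆ := Finite.of_injective _ (Subgroup.inclusion_injective hcomm)
  exact PseudoFinite.isFiniteByAbelian_of_finite_commutator H
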